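/- For $\sigma\in S_k$ and $\tau\in S_l$, the direct sum $\sigma\oplus\tau\in S_{k+l}$ is given by $(\sigma\oplus\tau)(i)=\sigma(i)$ for $1\le i\le k$ and $(\sigma\oplus\tau)(i)=\tau(i-k)+k$ for $k+1\le i\le k+l$; the skew sum $\sigma\ominus\tau\in S_{k+l}$ is given by $(\sigma\ominus\tau)(i)=\sigma(i)+l$ for $1\le i\le k$ and $(\sigma\ominus\tau)(i)=\tau(i-k)$ for $k+1\le i\le k+l$. A permutation is separable if it can be obtained from the singleton permutation in $S_1$ by iterating direct sums and skew sums. Let $E_n^{\mathrm{sep}}$ denote the expectation with respect to the uniform probability measure on the set of separable permutations in $S_n$, $n\ge1$. An alternating subsequence of length $k$ of $\sigma=\sigma_1\cdots\sigma_n\in S_n$ is a subsequence of the form $\sigma_{i_1}>\sigma_{i_2}<\sigma_{i_3}>\cdots\sigma_{i_k}$ or $\sigma_{i_1}<\sigma_{i_2}>\sigma_{i_3}<\cdots\sigma_{i_k}$, where $1\le i_1<\cdots<i_k\le n$. Let $A_n(\sigma)$ be the length of the longest alternating subsequence of $\sigma$. For $s,e\in\{+,-\}$, let $A_n^{s,e}(\sigma)$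 be the length of the longest alternating subsequence of $\sigma$ whose first step is an ascent if $s=+$ and a descent if $s=-$, and whose last step is an ascent if $e=+$ and a descent if $e=-$; a single entry counts as an alternating subsequence of the types $(+,-)$ and $(-,+)$, but not of the types $(+,+)$ and $(-,-)$, and $A_n^{s,e}(\sigma)=0$ if $\sigma$ has no alternating subsequence of the type $(s,e)$. Theorem. As $n\to\infty$, $$E_n^{\mathrm{sep}}A_n\sim(2-\sqrt2)\,n\approx 0.5858\,n,$$ and, for each of the four choices of $s,e\in\{+,-\}$, $$E_n^{\mathrm{sep}}A_n^{s,e}\sim(2-\sqrt2)\,n.$$ Here $2-\sqrt2\approx0.5858$ is meant to four decimal places, that is, $|(2-\sqrt2)-0.5858|<0.00005$. -/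

import Mathlib

open Filter Asymptotics

namespace SepAlt

/-- The direct sum of `σ ∈ S_k` and `τ ∈ S_l`: it maps `i` to `σ i` for `i < k` and `k + j`
to `k + τ j` for `j < l` (everything is 0-indexed). -/
def directSum {k l : ℕ} (σ : Equiv.Perm (Fin k)) (τ : Equiv.Perm (Fin l)) :
    Equiv.Perm (Fin (k + l)) :=
  (finSumFinEquiv.symm.trans (Equiv.sumCongr σ τ)).trans finSumFinEquiv

/-- The skew sum of `σ ∈ S_k` and `τ ∈ S_l`: it maps `i` to `l + σ i` for `i < k` and `k + j`
to `τ j` for `j < l` (everything is 0-indexed). -/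
def skewSum {k l : ℕ} (σ : Equiv.Perm (Fin k)) (τ : Equiv.Perm (Fin l)) :
    Equiv.Perm (Fin (k + l)) :=
  (((finSumFinEquiv.symm.trans (Equiv.sumCongr σ τ)).trans (Equiv.sumComm _ _)).trans
    finSumFinEquiv).trans (finCongr (Nat.add_comm l k))

/-- A permutation is separable if it can be obtained from the singleton permutation by iterating
direct sums and skew sums. -/
inductive IsSeparable : ∀ {n : ℕ}, Equiv.Perm (Fin n) → Prop
  | singleton : IsSeparable (1 : Equiv.Perm (Fin 1))
  | directSum {k l : ℕ} {σ : Equiv.Perm (Fin k)} {τ : Equiv.Perm (Fin l)} :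
      IsSeparable σ → IsSeparable τ → IsSeparable (directSum σ τ)
  | skewSum {k l : ℕ} {σ : Equiv.Perm (Fin k)} {τ : Equiv.Perm (Fin l)} :
      IsSeparable σ → IsSeparable τ → IsSeparable (skewSum σ τ)

open Classical in
/-- The set of separable permutations in `S_n`. -/
noncomputable def SEP (n : ℕ) : Finset (Equiv.Perm (Fin n)) :=
  Finset.univ.filter fun σ => IsSeparable σ

/-- Expectation with respect to the uniform probability measure on `SEP n`. -/
noncomputable def expSep (n : ℕ) (X : Equiv.Perm (Fin n) → ℕ) : ℝ :=
  (∑ σ ∈ SEP n, (X σ : ℝ)) / ((SEP n).card : ℝ)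

/-- The two kinds of steps: ascent (`+`) and descent (`-`). -/
inductive Step
  | ascent : Step
  | descent : Step

/-- The opposite kind of step. -/
def Step.opp : Step → Step
  | .ascent => .descent
  | .descent => .ascent

/-- `s.Rel x y`: going from `x` to `y` is a step of the kind `s`. -/
def Step.Rel {α : Type*} [LT α] : Step → α → α → Prop
  | .ascent, x, y => x < y
  | .descent, x, y => y < x

/-- The list is alternating, and its first step (if there is one) is of the kind `s`. -/
def IsAlt {α : Type*} [LT α] : Step → List α → Prop
  | _, [] => True
  | _, [_] => True
  | s, x :: y :: l => s.Rel x y ∧ IsAlt s.opp (y :: l)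

/-- The list is alternating of the type `(s, e)`: its first step is of the kind `s` and its last
step is of the kind `e`. By convention, a singleton is of the types `(+,-)` and `(-,+)`, and not of
the types `(+,+)` and `(-,-)`. (The recursion removes the first entry; what remains begins with
a step of the opposite kind and ends as before, and the clause for singletons
makes `[x, y]` with `s.Rel x y` a list of the type `(s, s)` only.) -/
def IsAltType {α : Type*} [LT α] : Step → Step → List α → Prop
  | _, _, [] => False
  | s, e, [_] => e = s.opp
  | s, e, x :: y :: l => s.Rel x y ∧ IsAltType s.opp e (y :: l)

/-- The length of the longest alternating subsequence of `σ`; a subsequence is a sublist of the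
one-line notation of `σ`. -/
noncomputable def altLen {n : ℕ} (σ : Equiv.Perm (Fin n)) : ℕ :=
  sSup {m : ℕ | ∃ l : List (Fin n), l.Sublist (List.ofFn σ) ∧ (∃ s : Step, IsAlt s l) ∧
    l.length = m}

/-- The length of the longest alternating subsequence of the type `(s, e)` of `σ`; it is `0` if
there is no such subsequence. -/
noncomputable def altLenType (s e : Step) {n : ℕ} (σ : Equiv.Perm (Fin n)) : ℕ :=
  sSup {m : ℕ | ∃ l : List (Fin n), l.Sublist (List.ofFn σ) ∧ IsAltType s e l ∧ l.length = m}

end SepAlt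

/-!
Let `T` be the number of interior peaks and valleys (*turns*) of a permutation of at least two
letters. Choosing the first entry, the last entry and the entries at the turns gives an alternating
subsequence of length `T + 2`, and no longer one exists (`altLen_eq`). Prescribing the kinds of the
first and last steps costs at most two entries (`altLen_le_altLenType`). So everything reduces to
the mean of `T` over the separable permutations.

The turns are the changes in the word of ascents and descents (`steps`). The step word of a direct
sum or skew sum is `u ++ b :: v`, where `u` and `v` are the step words of the summands and `b` is
the kind of the step in between. A separable permutation of at least two letters is in exactly one
way a sum of exactly one of the two kinds, if the first summand is required to be indecomposable of
that kind (`sum_decomp`, `sum_indecomp`). Let `s` and `T(x)` be the generating functions of the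
number of separable permutations and of their total number of turns. Counting the turns inside the
summands and those at the two ends of the step in between, one finds
`s ^ 2 + (x - 1) * s + x = 0` (`sepGF_quadratic`) and
`T(x) * (1 - x - 2 * s) = s ^ 2 - x ^ 2` (`turnGF_mul`).

Now `1 - x - 2 * s` is the square root of `1 - 6 * x + x ^ 2`, and the coefficients `d n` of its
inverse are the central Delannoy numbers. Both the number of separable permutations
(`card_SEP`) and their total number of turns (`sum_turns`) are linear in
`d n, d (n + 1), d (n + 2)`:
`2 * (n + 2) * |SEP (n + 2)| = 3 * d (n + 1) - d n` and
`2 * T (n + 2) = d (n + 2) - 4 * d (n + 1) - d n`. The three-term recurrence of `d` makes the ratio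
`d (n + 1) / d n` converge to `ρ = 3 + 2 * √2` (`abs_delannoy_ratio_sub_le`), so the mean number of
turns divided by `n` tends to `(ρ ^ 2 - 4 * ρ - 1) / (3 * ρ - 1) = 2 - √2`.
-/

namespace SepAlt

/-! ### Step words and alternating sublists -/

@[simp] theorem Step.opp_opp (b : Step) : b.opp.opp = b := by cases b <;> rfl

theorem Step.opp_ne (b : Step) : b.opp ≠ b := by cases b <;> simp [Step.opp]

theorem Step.eq_or_eq_opp (b c : Step) : b = c ∨ b = c.opp := by
  cases b <;> cases c <;> simp [Step.opp]

theorem Step.eq_opp_of_ne {b c : Step} (h : b ≠ c) : b = c.opp :=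
  (b.eq_or_eq_opp c).resolve_left h

instance : DecidableEq Step := fun a b => by
  cases a <;> cases b <;> first | exact isTrue rfl | exact isFalse (by simp)

section LinearOrder

variable {α β : Type*} [LinearOrder α] [LinearOrder β]

theorem Step.Rel.trans {b : Step} {x y z : α} (h : b.Rel x y) (h' : b.Rel y z) : b.Rel x z := by
  cases b
  · exact lt_trans h h'
  · exact lt_trans h' h

theorem Step.Rel.asymm {b : Step} {x y : α} (h : b.Rel x y) : ¬ b.opp.Rel x y := by
  cases b
  · exact lt_asymm h
  · exact lt_asymm h

theorem Step.Rel.swap {b : Step} {x y : α} (h : b.Rel x y) : b.opp.Rel y x := by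
  cases b <;> exact h

theorem Step.Rel.irrefl {b : Step} {x : α} : ¬ b.Rel x x := by
  cases b <;> exact lt_irrefl x

theorem Step.Rel.eq {b c : Step} {x y : α} (h : b.Rel x y) (h' : c.Rel x y) : b = c := by
  rcases b.eq_or_eq_opp c with rfl | rfl
  · rfl
  · exact absurd h h'.asymm

/-- The kind of the step from `x` to `y` (a descent in the degenerate case `x = y`). -/
def stepOf (x y : α) : Step := if x < y then .ascent else .descent

theorem stepOf_rel {x y : α} (h : x ≠ y) : (stepOf x y).Rel x y := by
  unfold stepOf
  split_ifs with hlt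
  · exact hlt
  · exact lt_of_le_of_ne (not_lt.1 hlt) h.symm

theorem Step.Rel.stepOf_eq {b : Step} {x y : α} (h : b.Rel x y) : stepOf x y = b :=
  (stepOf_rel (fun e => Step.Rel.irrefl (e ▸ h))).eq h

/-- The word of the kinds of the consecutive steps of a list; it is shorter by one than the list
if the list is not empty. -/
def steps : List α → List Step
  | [] => []
  | [_] => []
  | x :: y :: l => stepOf x y :: steps (y :: l)

theorem steps_map {f : α → β} (hf : StrictMono f) : ∀ l : List α, steps (l.map f) = steps l
  | [] => rfl
  | [_] => rfl
  | x :: y :: l => by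
    have ih := steps_map hf (y :: l)
    simp only [List.map_cons] at ih
    simp only [List.map_cons, steps, ih, stepOf, hf.lt_iff_lt]

theorem steps_append {b : Step} : ∀ {l₁ l₂ : List α}, l₁ ≠ [] → l₂ ≠ [] →
    (∀ x ∈ l₁, ∀ y ∈ l₂, b.Rel x y) → steps (l₁ ++ l₂) = steps l₁ ++ b :: steps l₂
  | [], _, h, _, _ => absurd rfl h
  | _, [], _, h, _ => absurd rfl h
  | [x], y :: l, _, _, h => by
    simp [steps, (h x (by simp) y (by simp)).stepOf_eq]
  | x :: x' :: l, y :: l', _, _, h => by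
    have ih := steps_append (b := b) (l₁ := x' :: l) (l₂ := y :: l') (by simp) (by simp)
      (fun u hu v hv => h u (List.mem_cons_of_mem _ hu) v hv)
    simp only [List.cons_append] at ih
    simp [steps, ih]

/-- The number of places where two adjacent letters of a word differ. For the step word of a list
this is the number of interior peaks and valleys of the list. -/
def changes : List Step → ℕ
  | [] => 0
  | [_] => 0
  | a :: b :: w => (if a = b then 0 else 1) + changes (b :: w)

/-- If the first step of a list is `s`, then every alternating sublist that starts with a step `s`
can use each turn once; a sublist starting with the opposite step wastes the initial run. -/
theorem IsAlt.length_le {s : Step} : ∀ {l : List α} {x y : α}, (x :: y :: l).Nodup →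
    s.Rel x y → ∀ {m : List α}, m.Sublist (x :: y :: l) →
      (IsAlt s m → m.length ≤ changes (steps (x :: y :: l)) + 2) ∧
      (IsAlt s.opp m → m.length ≤ changes (steps (x :: y :: l)) + 1) := by
  intro l
  induction l generalizing s with
  | nil =>
    intro x y hd hs m hm
    have h2 : m.length ≤ 2 := by simpa using hm.length_le
    refine ⟨fun _ => by simpa using Nat.le_add_left_of_le h2, fun ha => ?_⟩
    by_contra hlt
    have hlen : m.length = 2 := by simp [steps, changes] at hlt; omega
    rw [hm.eq_of_length (by simp [hlen])] at ha
    exact hs.asymm ha.1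
  | cons z l ih =>
    intro x y hd hs m hm
    have hd' : (y :: z :: l).Nodup := hd.of_cons
    have hyz : y ≠ z := by
      intro h; simp [h] at hd'
    -- The bounds for sublists of the tail, expressed by the turns of the whole list.
    have key : ∀ {m : List α}, m.Sublist (y :: z :: l) →
        (IsAlt s m → m.length ≤ changes (steps (x :: y :: z :: l)) + 2) ∧
        (IsAlt s.opp m → m.length ≤ changes (steps (x :: y :: z :: l)) + 1) := by
      intro m hm
      have hst := stepOf_rel hyz
      have hc : changes (steps (x :: y :: z :: l)) =
          (if s = stepOf y z then 0 else 1) + changes (steps (y :: z :: l)) := by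
        simp [steps, changes, hs.stepOf_eq]
      by_cases he : stepOf y z = s
      · rw [he] at hst
        have := ih hd' hst hm
        simpa [hc, he] using this
      · have he' := Step.eq_opp_of_ne he
        rw [he'] at hst
        have := ih hd' hst hm
        rw [Step.opp_opp] at this
        rw [hc, if_neg (Ne.symm he)]
        exact ⟨fun h => by have := this.2 h; omega, fun h => by have := this.1 h; omega⟩
    rcases List.sublist_cons_iff.1 hm with h | ⟨r, rfl, hr⟩
    · exact key h
    · rcases r with _ | ⟨w, r⟩
      · simp
      refine ⟨fun ha => ?_, fun ha => ?_⟩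
      · have := (key hr).2 ha.2
        simpa using this
      · -- Replacing `x` by `y` yields an alternating sublist of the tail.
        have hw : s.opp.Rel y w := hs.swap.trans ha.1
        have hr' : (w :: r).Sublist (z :: l) := by
          rcases List.sublist_cons_iff.1 hr with h | ⟨r', hr', -⟩
          · exact h
          · exact absurd (List.cons.inj hr').1 (fun e => Step.Rel.irrefl (e ▸ hw))
        have := (key (hr'.cons_cons y)).2 ⟨hw, ha.2⟩
        simpa using this

/-- Taking the first entry, the entries at the turns and the last entry of a list gives an
alternating sublist. -/
theorem exists_isAlt_sublist {s : Step} : ∀ {l : List α} {x y : α}, (x :: y :: l).Nodup →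
    s.Rel x y → ∃ m : List α, m.Sublist (y :: l) ∧ IsAlt s (x :: m) ∧
      m.length = changes (steps (x :: y :: l)) + 1 := by
  intro l
  induction l generalizing s with
  | nil =>
    intro x y _ hs
    exact ⟨[y], List.Sublist.refl _, ⟨hs, trivial⟩, by simp [steps, changes]⟩
  | cons z l ih =>
    intro x y hd hs
    have hd' : (y :: z :: l).Nodup := hd.of_cons
    have hyz : y ≠ z := by
      intro h; simp [h] at hd'
    obtain ⟨m, hm, ha, hlen⟩ := ih hd' (stepOf_rel hyz)
    have hc : changes (steps (x :: y :: z :: l)) =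
        (if s = stepOf y z then 0 else 1) + changes (steps (y :: z :: l)) := by
      simp [steps, changes, hs.stepOf_eq]
    by_cases he : stepOf y z = s
    · refine ⟨m, hm.cons y, ?_, by simp [hc, he, hlen]⟩
      rw [he] at ha
      cases m with
      | nil => trivial
      | cons w m => exact ⟨hs.trans ha.1, ha.2⟩
    · refine ⟨y :: m, hm.cons_cons y, ⟨hs, Step.eq_opp_of_ne he ▸ ha⟩, ?_⟩
      rw [hc, if_neg (Ne.symm he), List.length_cons, hlen]
      omega

end LinearOrder

section Types

variable {α : Type*} [LT α]

theorem IsAltType.isAlt {s e : Step} : ∀ {m : List α}, IsAltType s e m → IsAlt s m := by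
  intro m
  induction m generalizing s with
  | nil => exact fun h => trivial
  | cons x m ih =>
    cases m with
    | nil => exact fun _ => trivial
    | cons y m => exact fun h => ⟨h.1, ih h.2⟩

theorem IsAlt.exists_isAltType {s : Step} : ∀ {m : List α}, m ≠ [] → IsAlt s m →
    ∃ e, IsAltType s e m := by
  intro m
  induction m generalizing s with
  | nil => exact fun h => absurd rfl h
  | cons x m ih =>
    cases m with
    | nil => exact fun _ _ => ⟨s.opp, rfl⟩
    | cons y m =>
      intro _ h
      obtain ⟨e, he⟩ := ih (by simp) h.2
      exact ⟨e, h.1, he⟩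

theorem IsAltType.dropLast {s e : Step} : ∀ {m : List α}, 2 ≤ m.length → IsAltType s e m →
    IsAltType s e.opp m.dropLast := by
  intro m
  induction m generalizing s with
  | nil => simp
  | cons x m ih =>
    cases m with
    | nil => simp
    | cons y m =>
      intro _ h
      cases m with
      | nil =>
        have : e = s.opp.opp := h.2
        rw [this, Step.opp_opp]
        rfl
      | cons z m => exact ⟨h.1, ih (by simp) h.2⟩

/-- An alternating list contains one of any prescribed type that is shorter by at most two: the
first and the last entry are dropped if necessary. -/
theorem IsAlt.exists_sublist_isAltType {s₀ : Step} (s e : Step) {m : List α}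
    (hm : 3 ≤ m.length) (h : IsAlt s₀ m) :
    ∃ r : List α, r.Sublist m ∧ IsAltType s e r ∧ m.length ≤ r.length + 2 := by
  obtain ⟨m', hsub, hlen, ha⟩ :
      ∃ m' : List α, m'.Sublist m ∧ m.length ≤ m'.length + 1 ∧ IsAlt s m' := by
    rcases s₀.eq_or_eq_opp s with rfl | rfl
    · exact ⟨m, List.Sublist.refl _, by omega, h⟩
    · match m, hm, h with
      | x :: y :: l, _, h => exact ⟨y :: l, List.sublist_cons_self _ _, by simp, by simpa using h.2⟩
  have hne : m' ≠ [] := by rintro rfl; simp at hlen; omega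
  obtain ⟨e', he'⟩ := ha.exists_isAltType hne
  rcases e.eq_or_eq_opp e' with rfl | rfl
  · exact ⟨m', hsub, he', by omega⟩
  · exact ⟨m'.dropLast, (List.dropLast_sublist _).trans hsub, he'.dropLast (by omega),
      by simp; omega⟩

end Types

/-- The number of interior peaks and valleys of a permutation. -/
def turns {n : ℕ} (σ : Equiv.Perm (Fin n)) : ℕ := changes (steps (List.ofFn σ))

theorem altLen_eq {n : ℕ} (hn : 2 ≤ n) (σ : Equiv.Perm (Fin n)) : altLen σ = turns σ + 2 := by
  have hd : (List.ofFn σ).Nodup := List.nodup_ofFn.2 σ.injective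
  have hlen : (List.ofFn σ).length = n := List.length_ofFn
  unfold altLen turns
  match hL : List.ofFn σ, hd, hlen with
  | [], _, h => simp at h; omega
  | [_], _, h => simp at h; omega
  | x :: y :: l, hd, _ =>
    have hxy : x ≠ y := by
      intro h; simp [h] at hd
    have hs := stepOf_rel hxy
    refine IsGreatest.csSup_eq ⟨?_, ?_⟩
    · obtain ⟨m, hm, ha, hlen⟩ := exists_isAlt_sublist hd hs
      exact ⟨x :: m, hm.cons_cons x, ⟨_, ha⟩, by simp [hlen]⟩
    · rintro k ⟨m, hm, ⟨s, ha⟩, rfl⟩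
      have := IsAlt.length_le hd hs hm
      rcases s.eq_or_eq_opp (stepOf x y) with rfl | rfl
      · exact this.1 ha
      · exact (this.2 ha).trans (by omega)

theorem bddAbove_lengths {n : ℕ} (σ : Equiv.Perm (Fin n)) (P : List (Fin n) → Prop) :
    BddAbove {m : ℕ | ∃ l : List (Fin n), l.Sublist (List.ofFn σ) ∧ P l ∧ l.length = m} := by
  refine ⟨n, ?_⟩
  rintro _ ⟨l, hl, -, rfl⟩
  simpa using hl.length_le

theorem altLenType_le_altLen (s e : Step) {n : ℕ} (σ : Equiv.Perm (Fin n)) :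
    altLenType s e σ ≤ altLen σ := by
  refine csSup_le' ?_
  rintro k ⟨l, hl, ha, rfl⟩
  exact le_csSup (bddAbove_lengths σ _) ⟨l, hl, ⟨s, ha.isAlt⟩, rfl⟩

theorem altLen_le_altLenType (s e : Step) {n : ℕ} (σ : Equiv.Perm (Fin n)) :
    altLen σ ≤ altLenType s e σ + 2 := by
  refine csSup_le' ?_
  rintro k ⟨l, hl, ⟨s₀, ha⟩, rfl⟩
  by_cases h3 : 3 ≤ l.length
  · obtain ⟨r, hr, hat, hlen⟩ := ha.exists_sublist_isAltType s e h3
    have : r.length ≤ altLenType s e σ :=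
      le_csSup (bddAbove_lengths σ _) ⟨r, hr.trans hl, hat, rfl⟩
    omega
  · omega

/-! ### One-line notations of separable permutations -/

/-- The shift of the second block when two blocks, of which the first has length `k`, are put
together by a step of the given kind. -/
def Step.shift : Step → ℕ → ℕ
  | .ascent, k => k
  | .descent, _ => 0

/-- The direct sum (for `ascent`) or skew sum (for `descent`) of one-line notations. -/
def join (b : Step) (l₁ l₂ : List ℕ) : List ℕ :=
  l₁.map (· + b.opp.shift l₂.length) ++ l₂.map (· + b.shift l₁.length)

theorem length_join (b : Step) (l₁ l₂ : List ℕ) :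
    (join b l₁ l₂).length = l₁.length + l₂.length := by simp [join]

theorem join_assoc (b : Step) (l₁ l₂ l₃ : List ℕ) :
    join b (join b l₁ l₂) l₃ = join b l₁ (join b l₂ l₃) := by
  cases b <;> simp [join, Step.shift, Step.opp, Function.comp_def] <;> intros <;> omega

/-- The one-line notations of separable permutations, with entries starting from `0`. -/
inductive SepList : List ℕ → Prop
  | singleton : SepList [0]
  | join (b : Step) {l₁ l₂ : List ℕ} : SepList l₁ → SepList l₂ → SepList (join b l₁ l₂)

theorem SepList.ne_nil {l : List ℕ} (h : SepList l) : l ≠ [] := by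
  induction h with
  | singleton => simp
  | join b h₁ h₂ ih₁ ih₂ => simp [SepAlt.join, ih₁]

theorem SepList.lt_length {l : List ℕ} (h : SepList l) : ∀ x ∈ l, x < l.length := by
  induction h with
  | singleton => simp
  | join b h₁ h₂ ih₁ ih₂ =>
    intro x hx
    rw [length_join]
    rcases List.mem_append.1 hx with hx | hx <;> obtain ⟨y, hy, rfl⟩ := List.mem_map.1 hx
    · have := ih₁ y hy
      cases b <;> simp [Step.shift, Step.opp] <;> omega
    · have := ih₂ y hy
      cases b <;> simp [Step.shift] <;> omega

theorem SepList.join_rel (b : Step) {l₁ l₂ : List ℕ} (h₁ : SepList l₁) (h₂ : SepList l₂) :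
    ∀ x ∈ l₁.map (· + b.opp.shift l₂.length), ∀ y ∈ l₂.map (· + b.shift l₁.length),
      b.Rel x y := by
  intro _ hx' _ hy'
  obtain ⟨x, hx, rfl⟩ := List.mem_map.1 hx'
  obtain ⟨y, hy, rfl⟩ := List.mem_map.1 hy'
  have := h₁.lt_length x hx
  have := h₂.lt_length y hy
  cases b <;> simp [Step.Rel, Step.shift, Step.opp] <;> omega

theorem SepList.steps_join (b : Step) {l₁ l₂ : List ℕ} (h₁ : SepList l₁) (h₂ : SepList l₂) :
    steps (SepAlt.join b l₁ l₂) = steps l₁ ++ b :: steps l₂ := by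
  rw [SepAlt.join, steps_append (by simpa using h₁.ne_nil) (by simpa using h₂.ne_nil)
    (h₁.join_rel b h₂), steps_map (add_left_strictMono), steps_map (add_left_strictMono)]

/-- The list splits into two nonempty blocks such that all steps from the first block to the second
one are of the kind `b`. -/
def Dec (b : Step) (l : List ℕ) : Prop :=
  ∃ l₁ l₂ : List ℕ, l₁ ≠ [] ∧ l₂ ≠ [] ∧ l = l₁ ++ l₂ ∧ ∀ x ∈ l₁, ∀ y ∈ l₂, b.Rel x y

theorem SepList.dec_join (b : Step) {l₁ l₂ : List ℕ} (h₁ : SepList l₁) (h₂ : SepList l₂) :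
    Dec b (SepAlt.join b l₁ l₂) :=
  ⟨_, _, by simpa using h₁.ne_nil, by simpa using h₂.ne_nil, rfl, h₁.join_rel b h₂⟩

theorem not_dec_singleton (b : Step) (x : ℕ) : ¬ Dec b [x] := by
  rintro ⟨l₁, l₂, h₁, h₂, h, -⟩
  have := congrArg List.length h
  have := List.length_pos_iff.2 h₁
  have := List.length_pos_iff.2 h₂
  simp at *
  omega

/-- A list is not decomposable in both ways: compare its first entry with its last entry. -/
theorem Dec.not_dec_opp {b : Step} {l : List ℕ} (h : Dec b l) : ¬ Dec b.opp l := by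
  have key : ∀ {c : Step}, Dec c l → ∀ hl : l ≠ [], c.Rel (l.head hl) (l.getLast hl) := by
    rintro c ⟨l₁, l₂, h₁, h₂, rfl, hr⟩ hl
    rw [List.head_append_of_ne_nil h₁, List.getLast_append_of_ne_nil _ h₂]
    exact hr _ (List.head_mem h₁) _ (List.getLast_mem h₂)
  have hl : l ≠ [] := by
    obtain ⟨l₁, l₂, h₁, h₂, rfl, -⟩ := h
    simp [h₁]
  exact fun h' => (key h hl).asymm (key h' hl)

/-- The first summand can be taken indecomposable: otherwise it is a sum of the same kind, and
reassociating moves its second summand to the right. -/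
theorem SepList.exists_join {l : List ℕ} (h : SepList l) :
    l = [0] ∨ ∃ b l₁ l₂, SepList l₁ ∧ SepList l₂ ∧ ¬ Dec b l₁ ∧ l = SepAlt.join b l₁ l₂ := by
  induction h with
  | singleton => exact Or.inl rfl
  | @join b l₁ l₂ h₁ h₂ ih₁ _ =>
    right
    rcases ih₁ with rfl | ⟨c, m₁, m₂, hm₁, hm₂, hd, rfl⟩
    · exact ⟨b, [0], l₂, .singleton, h₂, not_dec_singleton b 0, rfl⟩
    rcases b.eq_or_eq_opp c with rfl | rfl
    · exact ⟨b, m₁, SepAlt.join b m₂ l₂, hm₁, hm₂.join b h₂, hd, join_assoc b m₁ m₂ l₂⟩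
    · exact ⟨c.opp, _, l₂, h₁, h₂, (hm₁.dec_join c hm₂).not_dec_opp, rfl⟩

theorem SepList.eq_singleton_or_dec {l : List ℕ} (h : SepList l) : l = [0] ∨ ∃ b, Dec b l := by
  rcases h.exists_join with h | ⟨b, l₁, l₂, h₁, h₂, -, rfl⟩
  · exact Or.inl h
  · exact Or.inr ⟨b, h₁.dec_join b h₂⟩

theorem SepList.exists_join_of_dec {b : Step} {l : List ℕ} (h : SepList l) (hd : Dec b l) :
    ∃ l₁ l₂, SepList l₁ ∧ SepList l₂ ∧ ¬ Dec b l₁ ∧ l = SepAlt.join b l₁ l₂ := by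
  rcases h.exists_join with rfl | ⟨c, l₁, l₂, h₁, h₂, hi, rfl⟩
  · exact absurd hd (not_dec_singleton b 0)
  rcases b.eq_or_eq_opp c with rfl | rfl
  · exact ⟨l₁, l₂, h₁, h₂, hi, rfl⟩
  · exact absurd hd (h₁.dec_join c h₂).not_dec_opp

theorem Dec.of_map_add {b : Step} {l : List ℕ} {c : ℕ} (h : Dec b (l.map (· + c))) : Dec b l := by
  obtain ⟨l₁, l₂, h₁, h₂, h, hr⟩ := h
  obtain ⟨m₁, m₂, rfl, rfl, rfl⟩ := List.map_eq_append_iff.1 h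
  refine ⟨m₁, m₂, by simpa using h₁, by simpa using h₂, rfl, fun x hx y hy => ?_⟩
  have := hr _ (List.mem_map_of_mem hx) _ (List.mem_map_of_mem hy)
  cases b <;> simpa [Step.Rel] using this

/-- If the first block of a decomposition were a proper prefix of the first block of another one,
then the latter block would be decomposable. -/
theorem SepList.length_le_of_join_eq {b : Step} {l₁ l₂ m₁ m₂ : List ℕ}
    (h₁ : SepList l₁) (h₂ : SepList l₂) (hm : ¬ Dec b m₁)
    (h : SepAlt.join b l₁ l₂ = SepAlt.join b m₁ m₂) : m₁.length ≤ l₁.length := by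
  by_contra! hlt
  have hr := h₁.join_rel b h₂
  unfold SepAlt.join at h
  rcases List.append_eq_append_iff.1 h with ⟨r, hr₁, hr₂⟩ | ⟨r, hr₁, hr₂⟩
  · refine hm (Dec.of_map_add (c := b.opp.shift m₂.length)
      ⟨_, r, ?_, ?_, hr₁, fun x hx y hy => hr x hx y ?_⟩)
    · simpa using h₁.ne_nil
    · rintro rfl
      have := congrArg List.length hr₁
      simp at this
      omega
    · rw [hr₂]
      exact List.mem_append_left _ hy
  · have := congrArg List.length hr₁
    simp at this
    omega

/-- The decomposition with an indecomposable first summand is unique. -/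
theorem SepList.join_inj {b : Step} {l₁ l₂ m₁ m₂ : List ℕ}
    (h₁ : SepList l₁) (h₂ : SepList l₂) (hl : ¬ Dec b l₁)
    (h₁' : SepList m₁) (h₂' : SepList m₂) (hm : ¬ Dec b m₁)
    (h : SepAlt.join b l₁ l₂ = SepAlt.join b m₁ m₂) : l₁ = m₁ ∧ l₂ = m₂ := by
  have e₁ : l₁.length = m₁.length :=
    le_antisymm (h₁'.length_le_of_join_eq h₂' hl h.symm) (h₁.length_le_of_join_eq h₂ hm h)
  have e₂ : l₂.length = m₂.length := by
    have := congrArg List.length h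
    rw [length_join, length_join] at this
    omega
  unfold SepAlt.join at h
  rw [← e₁, ← e₂] at h
  obtain ⟨h, h'⟩ := List.append_inj h (by simpa using e₁)
  exact ⟨List.map_injective_iff.2 (add_left_injective _) h,
    List.map_injective_iff.2 (add_left_injective _) h'⟩

/-- The one-line notation of a permutation as a list of natural numbers. -/
def toList {n : ℕ} (σ : Equiv.Perm (Fin n)) : List ℕ := (List.ofFn σ).map Fin.val

theorem toList_injective {n : ℕ} : Function.Injective (toList (n := n)) := by
  intro σ τ h
  exact DFunLike.coe_injective
    (List.ofFn_injective (List.map_injective_iff.2 Fin.val_injective h))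

theorem toList_directSum {k l : ℕ} (σ : Equiv.Perm (Fin k)) (τ : Equiv.Perm (Fin l)) :
    toList (directSum σ τ) = join .ascent (toList σ) (toList τ) := by
  simp only [toList, List.map_ofFn, join, Step.shift, Step.opp, List.length_ofFn]
  rw [← List.ofFn_fin_append]
  congr 1
  funext i
  induction i using Fin.addCases with
  | left i => simp [directSum]
  | right i => simp [directSum, add_comm]

theorem toList_skewSum {k l : ℕ} (σ : Equiv.Perm (Fin k)) (τ : Equiv.Perm (Fin l)) :
    toList (skewSum σ τ) = join .descent (toList σ) (toList τ) := by
  simp only [toList, List.map_ofFn, join, Step.shift, Step.opp, List.length_ofFn]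
  rw [← List.ofFn_fin_append]
  congr 1
  funext i
  induction i using Fin.addCases with
  | left i => simp [skewSum, add_comm]
  | right i => simp [skewSum]

theorem IsSeparable.sepList {n : ℕ} {σ : Equiv.Perm (Fin n)} (h : IsSeparable σ) :
    SepList (toList σ) := by
  induction h with
  | singleton => exact SepList.singleton
  | directSum _ _ ih₁ ih₂ => exact toList_directSum _ _ ▸ ih₁.join _ ih₂
  | skewSum _ _ ih₁ ih₂ => exact toList_skewSum _ _ ▸ ih₁.join _ ih₂

theorem SepList.exists_perm {l : List ℕ} (h : SepList l) :
    ∃ (n : ℕ) (σ : Equiv.Perm (Fin n)), IsSeparable σ ∧ toList σ = l := by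
  induction h with
  | singleton => exact ⟨1, 1, .singleton, rfl⟩
  | join b _ _ ih₁ ih₂ =>
    obtain ⟨k, σ, hσ, rfl⟩ := ih₁
    obtain ⟨m, τ, hτ, rfl⟩ := ih₂
    cases b
    · exact ⟨_, _, hσ.directSum hτ, toList_directSum σ τ⟩
    · exact ⟨_, _, hσ.skewSum hτ, toList_skewSum σ τ⟩

/-- The one-line notations of the separable permutations in `S_n`. -/
noncomputable def sepLists (n : ℕ) : Finset (List ℕ) := (SEP n).image toList

theorem mem_sepLists {n : ℕ} {l : List ℕ} : l ∈ sepLists n ↔ SepList l ∧ l.length = n := by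
  simp only [sepLists, Finset.mem_image, SEP, Finset.mem_filter, Finset.mem_univ, true_and]
  constructor
  · rintro ⟨σ, hσ, rfl⟩
    exact ⟨hσ.sepList, by simp [toList]⟩
  · rintro ⟨h, hn⟩
    obtain ⟨k, σ, hσ, rfl⟩ := h.exists_perm
    obtain rfl : k = n := by simpa [toList] using hn
    exact ⟨σ, hσ, rfl⟩

theorem sum_SEP (n : ℕ) (f : List Step → ℝ) :
    ∑ σ ∈ SEP n, f (steps (List.ofFn σ)) = ∑ l ∈ sepLists n, f (steps l) := by
  rw [sepLists, Finset.sum_image toList_injective.injOn]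
  refine Finset.sum_congr rfl fun σ _ => ?_
  rw [toList, steps_map Fin.val_strictMono]

/-! ### Generating functions over separable permutations -/

open Classical in
/-- The separable one-line notations of length `n` that decompose with sign `b`. -/
noncomputable def decomp (b : Step) (n : ℕ) : Finset (List ℕ) :=
  (sepLists n).filter (Dec b)

open Classical in
/-- The separable one-line notations of length `n` that do not decompose with sign `b`. -/
noncomputable def indecomp (b : Step) (n : ℕ) : Finset (List ℕ) :=
  (sepLists n).filter fun l => ¬ Dec b l

theorem mem_decomp {b : Step} {n : ℕ} {l : List ℕ} :
    l ∈ decomp b n ↔ (SepList l ∧ l.length = n) ∧ Dec b l := by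
  simp [decomp, mem_sepLists]

theorem mem_indecomp {b : Step} {n : ℕ} {l : List ℕ} :
    l ∈ indecomp b n ↔ (SepList l ∧ l.length = n) ∧ ¬ Dec b l := by
  simp [indecomp, mem_sepLists]

/-- Unique decomposition: the lists that decompose with sign `b` are the joins of an indecomposable
one and an arbitrary one. -/
theorem sum_decomp (b : Step) (n : ℕ) (f : List Step → ℝ) :
    ∑ l ∈ decomp b n, f (steps l) =
      ∑ p ∈ Finset.HasAntidiagonal.antidiagonal n, ∑ l₁ ∈ indecomp b p.1,
        ∑ l₂ ∈ sepLists p.2, f (steps l₁ ++ b :: steps l₂) := by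
  simp_rw [← Finset.sum_product']
  rw [Finset.sum_sigma']
  symm
  refine Finset.sum_bij (fun x _ => join b x.2.1 x.2.2) ?_ ?_ ?_ ?_
  · rintro ⟨⟨k, m⟩, l₁, l₂⟩ h
    simp only [Finset.mem_sigma, Finset.HasAntidiagonal.mem_antidiagonal, Finset.mem_product,
      mem_indecomp, mem_sepLists] at h
    obtain ⟨h, ⟨⟨h₁, e₁⟩, -⟩, h₂, e₂⟩ := h
    exact mem_decomp.2 ⟨⟨h₁.join b h₂, (length_join b l₁ l₂).trans
      ((congrArg₂ (· + ·) e₁ e₂).trans h)⟩, h₁.dec_join b h₂⟩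
  · rintro ⟨⟨k, m⟩, l₁, l₂⟩ h ⟨⟨k', m'⟩, l₁', l₂'⟩ h' he
    simp only [Finset.mem_sigma, Finset.HasAntidiagonal.mem_antidiagonal, Finset.mem_product,
      mem_indecomp, mem_sepLists] at h h'
    obtain ⟨-, ⟨⟨h₁, rfl⟩, hi⟩, h₂, rfl⟩ := h
    obtain ⟨-, ⟨⟨h₁', rfl⟩, hi'⟩, h₂', rfl⟩ := h'
    obtain ⟨rfl, rfl⟩ := h₁.join_inj h₂ hi h₁' h₂' hi' he
    rfl
  · intro l hl
    obtain ⟨⟨h, rfl⟩, hd⟩ := mem_decomp.1 hl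
    obtain ⟨l₁, l₂, h₁, h₂, hi, rfl⟩ := h.exists_join_of_dec hd
    refine ⟨⟨⟨l₁.length, l₂.length⟩, l₁, l₂⟩, ?_, rfl⟩
    simp only [Finset.mem_sigma, Finset.HasAntidiagonal.mem_antidiagonal, Finset.mem_product,
      mem_indecomp, mem_sepLists]
    exact ⟨(length_join b l₁ l₂).symm, ⟨⟨h₁, trivial⟩, hi⟩, h₂, trivial⟩
  · rintro ⟨⟨k, m⟩, l₁, l₂⟩ h
    simp only [Finset.mem_sigma, Finset.HasAntidiagonal.mem_antidiagonal, Finset.mem_product,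
      mem_indecomp, mem_sepLists] at h
    obtain ⟨-, ⟨⟨h₁, -⟩, -⟩, h₂, -⟩ := h
    simp only [h₁.steps_join b h₂]

theorem sum_indecomp (b : Step) (n : ℕ) (f : List Step → ℝ) :
    ∑ l ∈ indecomp b n, f (steps l) =
      (if n = 1 then f [] else 0) + ∑ l ∈ decomp b.opp n, f (steps l) := by
  have hd : Disjoint (if n = 1 then ({[0]} : Finset (List ℕ)) else ∅) (decomp b.opp n) := by
    split_ifs
    · rw [Finset.disjoint_singleton_left, mem_decomp]
      exact fun h => not_dec_singleton _ _ h.2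
    · simp
  have hu : indecomp b n = (if n = 1 then {[0]} else ∅) ∪ decomp b.opp n := by
    ext l
    rw [Finset.mem_union, mem_indecomp, mem_decomp]
    constructor
    · rintro ⟨⟨h, rfl⟩, hi⟩
      rcases h.eq_singleton_or_dec with rfl | ⟨c, hc⟩
      · simp
      · have hcb : c ≠ b := fun e => hi (e ▸ hc)
        exact Or.inr ⟨⟨h, rfl⟩, Step.eq_opp_of_ne hcb ▸ hc⟩
    · rintro (h | ⟨h, hd⟩)
      · split_ifs at h with hn
        · obtain rfl := Finset.mem_singleton.1 h
          exact ⟨⟨.singleton, hn.symm⟩, not_dec_singleton b 0⟩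
        · simp at h
      · exact ⟨h, fun h' => h'.not_dec_opp hd⟩
  rw [hu, Finset.sum_union hd]
  split_ifs <;> simp [steps]

/-- The generating function, by length, of a statistic of the step words of the lists in a family of
finite sets. -/
noncomputable def genFun (A : ℕ → Finset (List ℕ)) (f : List Step → ℝ) : PowerSeries ℝ :=
  PowerSeries.mk fun n => ∑ l ∈ A n, f (steps l)

theorem genFun_add (A : ℕ → Finset (List ℕ)) (f g : List Step → ℝ) :
    genFun A (f + g) = genFun A f + genFun A g := by
  ext n
  simp [genFun, Finset.sum_add_distrib]

theorem genFun_indecomp (b : Step) (f : List Step → ℝ) :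
    genFun (indecomp b) f = PowerSeries.C (f []) * PowerSeries.X + genFun (decomp b.opp) f := by
  ext n
  simp [genFun, sum_indecomp, PowerSeries.coeff_X]

open Classical in
theorem genFun_sepLists (b : Step) (f : List Step → ℝ) :
    genFun sepLists f = PowerSeries.C (f []) * PowerSeries.X + genFun (decomp b) f +
      genFun (decomp b.opp) f := by
  have h : genFun sepLists f = genFun (decomp b) f + genFun (indecomp b) f := by
    ext n
    simp only [genFun, PowerSeries.coeff_mk, map_add, decomp, indecomp]
    exact (Finset.sum_filter_add_sum_filter_not _ _ _).symm
  rw [h, genFun_indecomp]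
  ring

/-- A statistic of `u ++ b :: v` that is a sum of products of statistics of `u` and `v` turns unique
decomposition into an equation of generating functions. -/
theorem genFun_decomp {ι : Type*} [Fintype ι] (b : Step) {f : List Step → ℝ}
    (g h : ι → List Step → ℝ) (hf : ∀ u v, f (u ++ b :: v) = ∑ i, g i u * h i v) :
    genFun (decomp b) f = ∑ i, genFun (indecomp b) (g i) * genFun sepLists (h i) := by
  ext n
  simp only [map_sum, PowerSeries.coeff_mul, genFun, PowerSeries.coeff_mk, sum_decomp, hf]
  symm
  rw [Finset.sum_comm]
  refine Finset.sum_congr rfl fun p _ => ?_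
  simp_rw [Finset.sum_mul_sum]
  rw [Finset.sum_comm]
  exact Finset.sum_congr rfl fun _ _ => Finset.sum_comm

/-- The indicator of the words with first letter `b`. -/
def headInd (b : Step) (w : List Step) : ℝ := if w.head? = some b then 1 else 0

/-- The indicator of the words with last letter `b`. -/
def lastInd (b : Step) (w : List Step) : ℝ := if w.getLast? = some b then 1 else 0

/-- The indicator of the empty word. -/
def nilInd (w : List Step) : ℝ := if w = [] then 1 else 0

/-- Inserting a letter between two words creates a change at each neighbour different from it. -/
theorem changes_append (b : Step) : ∀ u v : List Step, (changes (u ++ b :: v) : ℝ) =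
    changes u + changes v + lastInd b.opp u + headInd b.opp v
  | [], [] => by simp [changes, lastInd, headInd]
  | [], c :: v => by
    rcases c.eq_or_eq_opp b with rfl | rfl <;>
      simp [changes, lastInd, headInd, (Step.opp_ne _).symm, add_comm]
  | [a], v => by
    have := changes_append b [] v
    rcases a.eq_or_eq_opp b with rfl | rfl <;>
      simp_all [changes, lastInd, headInd, Step.opp_ne, (Step.opp_ne _).symm]
    ring
  | a :: a' :: u, v => by
    have := changes_append b (a' :: u) v
    simp only [List.cons_append] at this
    simp only [List.cons_append, changes, Nat.cast_add, this, lastInd, List.getLast?_cons_cons]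
    ring

theorem headInd_sum (b : Step) : headInd b + headInd b.opp + nilInd = 1 := by
  funext w
  rcases w with _ | ⟨c, w⟩
  · simp [headInd, nilInd]
  · rcases c.eq_or_eq_opp b with rfl | rfl <;>
      simp [headInd, nilInd, Step.opp_ne, (Step.opp_ne _).symm]

theorem lastInd_sum (b : Step) : lastInd b + lastInd b.opp + nilInd = 1 := by
  funext w
  rcases w.eq_nil_or_concat with rfl | ⟨w, c, rfl⟩
  · simp [lastInd, nilInd]
  · rcases c.eq_or_eq_opp b with rfl | rfl <;>
      simp [lastInd, nilInd, Step.opp_ne, (Step.opp_ne _).symm]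

theorem lastInd_append (b : Step) (u v : List Step) :
    lastInd b (u ++ b :: v) = nilInd v + lastInd b v := by
  rcases v with _ | ⟨c, v⟩
  · simp [lastInd, nilInd]
  · simp [lastInd, nilInd, List.getLast?_append]

open PowerSeries

/-- The generating function of the number of separable permutations. -/
noncomputable def sepGF : PowerSeries ℝ := genFun sepLists 1

/-- The generating function of the total number of turns of separable permutations. -/
noncomputable def turnGF : PowerSeries ℝ := genFun sepLists fun w => (changes w : ℝ)

theorem genFun_decomp_one (b : Step) :
    genFun (decomp b) 1 = (X + genFun (decomp b.opp) 1) * sepGF := by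
  rw [genFun_decomp (ι := Unit) b (fun _ => 1) (fun _ => 1) (by simp)]
  simp [genFun_indecomp, sepGF]

theorem constantCoeff_sepGF : constantCoeff sepGF = 0 := by
  rw [← coeff_zero_eq_constantCoeff_apply, sepGF, genFun, coeff_mk]
  refine Finset.sum_eq_zero fun l hl => ?_
  obtain ⟨h, h0⟩ := mem_sepLists.1 hl
  exact absurd (List.length_eq_zero_iff.1 h0) h.ne_nil

/-- Decomposable permutations of both signs are equinumerous. -/
theorem genFun_decomp_opp_one (b : Step) : genFun (decomp b.opp) 1 = genFun (decomp b) 1 := by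
  have h₁ := genFun_decomp_one b
  have h₂ := genFun_decomp_one b.opp
  rw [Step.opp_opp] at h₂
  -- The difference of the equations for the two signs has the factor `1 + sepGF`.
  have hs : (1 + sepGF) ≠ 0 := by
    intro h
    have := congrArg constantCoeff h
    simp [constantCoeff_sepGF] at this
  have : (1 + sepGF) * (genFun (decomp b.opp) 1 - genFun (decomp b) 1) = 0 := by
    linear_combination h₂ - h₁
  exact sub_eq_zero.1 ((mul_eq_zero.1 this).resolve_left hs)

theorem two_mul_genFun_decomp_one (b : Step) : 2 * genFun (decomp b) 1 = sepGF - X := by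
  have := genFun_sepLists b 1
  rw [genFun_decomp_opp_one] at this
  simp only [Pi.one_apply, map_one, one_mul] at this
  rw [sepGF, this]
  ring

theorem two_mul_genFun_indecomp_one (b : Step) : 2 * genFun (indecomp b) 1 = sepGF + X := by
  have := two_mul_genFun_decomp_one b.opp
  simp only [genFun_indecomp, Pi.one_apply, map_one, one_mul]
  linear_combination this

theorem sepGF_quadratic : sepGF ^ 2 + (X - 1) * sepGF + X = 0 := by
  have h := genFun_decomp_one .ascent
  have h₁ := two_mul_genFun_decomp_one .ascent
  have h₂ := two_mul_genFun_decomp_one Step.ascent.opp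
  linear_combination -2 * h + h₁ - sepGF * h₂

/-- The step word is empty only for the one-letter permutation. -/
theorem genFun_nilInd : genFun sepLists nilInd = X := by
  have h : ∀ b, genFun (decomp b) nilInd = 0 := fun b => by
    rw [genFun_decomp (ι := Empty) b (fun _ => 1) (fun _ => 1) (by simp [nilInd])]
    simp
  simp [genFun_sepLists .ascent, h, nilInd]

/-- If the last step of a sum is of the kind of the joining step, the second summand is a singleton
or has such a last step itself. -/
theorem genFun_lastInd_decomp (b : Step) :
    genFun (decomp b) (lastInd b) =
      genFun (indecomp b) 1 * (X + genFun sepLists (lastInd b)) := by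
  rw [genFun_decomp (ι := Unit) b (fun _ => 1) (fun _ => nilInd + lastInd b)
    (by simp [lastInd_append])]
  simp [genFun_add, genFun_nilInd]

theorem two_ne_zero_powerSeries : (2 : PowerSeries ℝ) ≠ 0 := by
  intro h
  have := congrArg constantCoeff h
  rw [map_ofNat, map_zero] at this
  norm_num at this

/-- The turns of a sum are those of the summands, one at the end of the first summand if its last
step differs from the joining step, and one at the start of the second summand if its first step
differs from the joining step. Only the totals over both signs of the joining step are needed, so
the distribution of the first step never has to be determined. -/
theorem turnGF_mul : turnGF * (1 - X - 2 * sepGF) = sepGF ^ 2 - X ^ 2 := by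
  have hT : ∀ b : Step, genFun (decomp b) (fun w => (changes w : ℝ)) =
      genFun (decomp b.opp) (fun w => (changes w : ℝ)) * sepGF
        + genFun (indecomp b) 1 * turnGF
        + genFun (decomp b.opp) (lastInd b.opp) * sepGF
        + genFun (indecomp b) 1 * genFun sepLists (headInd b.opp) := by
    intro b
    rw [genFun_decomp (ι := Fin 4) b
      ![fun w => (changes w : ℝ), 1, lastInd b.opp, 1]
      ![1, fun w => (changes w : ℝ), 1, headInd b.opp]
      (by simp [Fin.sum_univ_four, changes_append])]
    simp [Fin.sum_univ_four, genFun_indecomp, sepGF, turnGF, changes, lastInd]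
  have hsum : turnGF = genFun (decomp .ascent) (fun w => (changes w : ℝ)) +
      genFun (decomp Step.ascent.opp) (fun w => (changes w : ℝ)) := by
    rw [turnGF, genFun_sepLists .ascent]
    simp [changes]
  -- Every nonempty word begins with one of the two letters and ends with one of them.
  have hhead := congrArg (genFun sepLists) (headInd_sum .ascent)
  have hlast := congrArg (genFun sepLists) (lastInd_sum .ascent)
  rw [genFun_add, genFun_add, genFun_nilInd] at hhead hlast
  change _ = sepGF at hhead
  change _ = sepGF at hlast
  have h₁ := hT .ascent
  have h₂ := hT Step.ascent.opp
  rw [Step.opp_opp] at h₂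
  have hI₁ := two_mul_genFun_indecomp_one .ascent
  have hI₂ := two_mul_genFun_indecomp_one Step.ascent.opp
  have hl₁ := genFun_lastInd_decomp .ascent
  have hl₂ := genFun_lastInd_decomp Step.ascent.opp
  have hq := sepGF_quadratic
  rw [hl₁] at h₂
  rw [hl₂] at h₁
  generalize genFun (decomp .ascent) (fun w => (changes w : ℝ)) = a₁ at *
  generalize genFun (decomp Step.ascent.opp) (fun w => (changes w : ℝ)) = a₂ at *
  generalize genFun (indecomp .ascent) 1 = i₁ at *
  generalize genFun (indecomp Step.ascent.opp) 1 = i₂ at *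
  generalize genFun sepLists (lastInd .ascent) = p₁ at *
  generalize genFun sepLists (lastInd Step.ascent.opp) = p₂ at *
  generalize genFun sepLists (headInd .ascent) = r₁ at *
  generalize genFun sepLists (headInd Step.ascent.opp) = r₂ at *
  apply mul_left_cancel₀ two_ne_zero_powerSeries
  have e : i₁ = i₂ := mul_left_cancel₀ two_ne_zero_powerSeries (hI₁.trans hI₂.symm)
  subst e
  rw [hsum] at h₁ h₂ ⊢
  linear_combination 2 * h₁ + 2 * h₂ + 2 * i₁ * sepGF * hlast + 2 * i₁ * hhead +
    (2 * (a₁ + a₂) + sepGF * (X + sepGF) + sepGF - X) * hI₁ + (sepGF + X) * hq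

/-! ### The central Delannoy numbers and the asymptotics -/

/-- The square root `1 - X - 2 * sepGF` of `1 - 6 * X + X ^ 2`. -/
noncomputable def sqrtDisc : PowerSeries ℝ := 1 - X - 2 * sepGF

/-- The generating function `1 / sqrt (1 - 6 * X + X ^ 2)` of the central Delannoy numbers. -/
noncomputable def delannoyGF : PowerSeries ℝ := sqrtDisc⁻¹

theorem constantCoeff_sqrtDisc : constantCoeff sqrtDisc = 1 := by
  simp [sqrtDisc, constantCoeff_sepGF]

theorem delannoyGF_mul : delannoyGF * sqrtDisc = 1 :=
  PowerSeries.inv_mul_cancel _ (by simp [constantCoeff_sqrtDisc])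

theorem sqrtDisc_sq : sqrtDisc ^ 2 = 1 - 6 * X + X ^ 2 := by
  rw [sqrtDisc]
  linear_combination 4 * sepGF_quadratic

theorem two_mul_turnGF : 2 * turnGF = (1 - 4 * X - X ^ 2) * delannoyGF - (1 - X) := by
  have h : turnGF * sqrtDisc = sepGF ^ 2 - X ^ 2 := turnGF_mul
  have hs : sqrtDisc = 1 - X - 2 * sepGF := rfl
  linear_combination (-2 * turnGF - (1 - X)) * delannoyGF_mul + 2 * delannoyGF * h +
    2 * delannoyGF * sepGF_quadratic + (1 - X) * delannoyGF * hs

theorem sqrtDisc_mul_derivative : sqrtDisc * d⁄dX ℝ sqrtDisc = X - 3 := by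
  have h := congrArg (d⁄dX ℝ) sqrtDisc_sq
  have e6 : (6 : PowerSeries ℝ) = C 6 := (map_ofNat C 6).symm
  rw [e6, sq, sq] at h
  simp only [map_add, map_sub, Derivation.leibniz, smul_eq_mul, derivative_X, derivative_C,
    Derivation.map_one_eq_zero] at h
  rw [← e6] at h
  apply mul_left_cancel₀ two_ne_zero_powerSeries
  linear_combination h

/-- The number of separable permutations, multiplied by their length, is a combination of central
Delannoy numbers. -/
theorem delannoyGF_eq_derivative : (3 - X) * delannoyGF = 1 + 2 * d⁄dX ℝ sepGF := by
  have h : d⁄dX ℝ sqrtDisc = -1 - 2 * d⁄dX ℝ sepGF := by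
    have e2 : (2 : PowerSeries ℝ) = C 2 := (map_ofNat C 2).symm
    rw [sqrtDisc, e2]
    simp only [map_sub, Derivation.leibniz, smul_eq_mul, derivative_X, derivative_C,
      Derivation.map_one_eq_zero]
    ring
  linear_combination delannoyGF * sqrtDisc_mul_derivative - d⁄dX ℝ sqrtDisc * delannoyGF_mul - h

theorem derivative_delannoyGF :
    (1 - 6 * X + X ^ 2) * d⁄dX ℝ delannoyGF = (3 - X) * delannoyGF := by
  have h := congrArg (d⁄dX ℝ) delannoyGF_mul
  simp only [Derivation.leibniz, smul_eq_mul, Derivation.map_one_eq_zero] at h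
  linear_combination -d⁄dX ℝ delannoyGF * sqrtDisc_sq + sqrtDisc * h -
    delannoyGF * sqrtDisc_mul_derivative

/-- The central Delannoy numbers. -/
noncomputable def delannoy (n : ℕ) : ℝ := coeff n delannoyGF

theorem delannoy_zero : delannoy 0 = 1 := by
  have h := congrArg constantCoeff delannoyGF_mul
  rw [map_mul, constantCoeff_sqrtDisc, mul_one, map_one] at h
  rw [delannoy, coeff_zero_eq_constantCoeff_apply, h]

theorem coeff_ofNat_mul (n k : ℕ) [k.AtLeastTwo] (f : PowerSeries ℝ) :
    coeff n ((OfNat.ofNat k : PowerSeries ℝ) * f) = (OfNat.ofNat k : ℝ) * coeff n f := by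
  rw [← map_ofNat (C (R := ℝ)) k, coeff_C_mul]

theorem delannoy_one : delannoy 1 = 3 := by
  have h := congrArg constantCoeff derivative_delannoyGF
  have h0 := delannoy_zero
  have h1 := coeff_derivative delannoyGF 0
  rw [coeff_zero_eq_constantCoeff_apply] at h1
  rw [delannoy, coeff_zero_eq_constantCoeff_apply] at h0
  rw [map_mul, map_mul, h0, h1] at h
  have e3 : constantCoeff (3 : PowerSeries ℝ) = 3 := map_ofNat _ 3
  simpa [delannoy, e3] using h

theorem delannoy_rec (n : ℕ) : ((n : ℝ) + 2) * delannoy (n + 2) =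
    (6 * n + 9) * delannoy (n + 1) - (n + 1) * delannoy n := by
  have h := congrArg (coeff (n + 1)) derivative_delannoyGF
  have e : ∀ f : PowerSeries ℝ, (1 - 6 * X + X ^ 2) * f = f - 6 * (X * f) + X * (X * f) :=
    fun f => by ring
  rw [e, sub_mul, map_add, map_sub, map_sub, coeff_ofNat_mul, coeff_ofNat_mul,
    coeff_succ_X_mul, coeff_succ_X_mul, coeff_succ_X_mul] at h
  rcases n with _ | n
  · simp only [coeff_derivative, coeff_zero_X_mul] at h
    simp only [delannoy]
    push_cast at h ⊢
    linear_combination h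
  · simp only [coeff_succ_X_mul, coeff_derivative] at h
    simp only [delannoy]
    push_cast at h ⊢
    linear_combination h

theorem delannoy_pos_and_le (n : ℕ) : 0 < delannoy n ∧ 3 * delannoy n ≤ delannoy (n + 1) := by
  induction n with
  | zero => rw [delannoy_zero, delannoy_one]; norm_num
  | succ n ih =>
    obtain ⟨h, h'⟩ := ih
    have hn : (0 : ℝ) ≤ n := n.cast_nonneg
    refine ⟨by linarith, ?_⟩
    have := delannoy_rec n
    refine le_of_mul_le_mul_left (a := (n : ℝ) + 2) ?_ (by linarith)
    rw [this]
    nlinarith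

/-- The ratio of consecutive central Delannoy numbers satisfies a recurrence whose limit is a
contraction with fixed point `3 + 2 * √2`. -/
theorem abs_delannoy_ratio_sub_le (n : ℕ) :
    |delannoy (n + 1) / delannoy n - (3 + 2 * √2)| ≤ 6 / (n + 1) := by
  have hsq : √2 * √2 = 2 := Real.mul_self_sqrt (by norm_num)
  have h1 : 1 ≤ √2 := Real.one_le_sqrt.2 (by norm_num)
  induction n with
  | zero =>
    rw [delannoy_zero, delannoy_one, abs_le]
    constructor <;> norm_num <;> nlinarith
  | succ n ih =>
    obtain ⟨hp, h3⟩ := delannoy_pos_and_le n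
    obtain ⟨hp', -⟩ := delannoy_pos_and_le (n + 1)
    have hn : (0 : ℝ) ≤ n := n.cast_nonneg
    set ρ : ℝ := 3 + 2 * √2 with hρ
    set r : ℝ := delannoy (n + 1) / delannoy n with hr
    have hr3 : 3 ≤ r := (le_div_iff₀ hp).2 h3
    have hρ3 : 3 ≤ ρ := by linarith
    -- The fixed-point equation of the limiting recurrence `r ↦ 6 - 1 / r`.
    have hρρ : ρ * ρ = 6 * ρ - 1 := by rw [hρ]; linear_combination 4 * hsq
    have hrec : delannoy (n + 1 + 1) / delannoy (n + 1) - ρ =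
        -(3 - 1 / r) / (n + 2) + (r - ρ) / (r * ρ) := by
      have e₁ : delannoy (n + 1 + 1) / delannoy (n + 1) =
          ((6 * n + 9) - (n + 1) / r) / (n + 2) := by
        rw [hr]
        field_simp
        linear_combination delannoy_rec n
      rw [e₁]
      field_simp
      linear_combination (-(n : ℝ) - 2) * r * hρρ
    have b₁ : |-(3 - 1 / r) / ((n : ℝ) + 2)| ≤ 3 / (n + 2) := by
      rw [abs_div, abs_neg, abs_of_pos (by linarith : (0 : ℝ) < n + 2)]
      have hr1 : 1 / r ≤ 1 := by rw [div_le_one (by linarith)]; linarith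
      have hr0 : 0 < 1 / r := by positivity
      gcongr
      rw [abs_le]
      constructor <;> linarith
    have b₂ : |(r - ρ) / (r * ρ)| ≤ 6 / (n + 1) / 9 := by
      rw [abs_div, abs_of_pos (by positivity : 0 < r * ρ)]
      gcongr
      nlinarith
    rw [hrec]
    refine (abs_add_le _ _).trans ((add_le_add b₁ b₂).trans ?_)
    push_cast
    rw [div_div, div_add_div _ _ (by positivity) (by positivity),
      div_le_div_iff₀ (by positivity) (by positivity)]
    nlinarith

theorem tendsto_delannoy_ratio :
    Tendsto (fun n => delannoy (n + 1) / delannoy n) atTop (nhds (3 + 2 * √2)) := by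
  rw [tendsto_iff_norm_sub_tendsto_zero]
  refine squeeze_zero (fun _ => norm_nonneg _) abs_delannoy_ratio_sub_le ?_
  have := (tendsto_one_div_add_atTop_nhds_zero_nat (𝕜 := ℝ)).const_mul 6
  simpa [div_eq_mul_inv] using this

theorem coeff_sepGF (n : ℕ) : coeff n sepGF = (SEP n).card := by
  have := sum_SEP n 1
  simp only [Pi.one_apply, Finset.sum_const, nsmul_eq_mul, mul_one] at this
  simp [sepGF, genFun, this]

theorem coeff_turnGF (n : ℕ) : coeff n turnGF = ∑ σ ∈ SEP n, (turns σ : ℝ) := by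
  rw [turnGF, genFun, coeff_mk]
  exact (sum_SEP n fun w => (changes w : ℝ)).symm

theorem card_SEP (n : ℕ) :
    2 * ((n : ℝ) + 2) * (SEP (n + 2)).card = 3 * delannoy (n + 1) - delannoy n := by
  have h := congrArg (coeff (n + 1)) delannoyGF_eq_derivative
  rw [sub_mul, map_sub, map_add, coeff_ofNat_mul, coeff_ofNat_mul, coeff_succ_X_mul,
    coeff_derivative, coeff_sepGF, coeff_one, if_neg n.succ_ne_zero] at h
  simp only [delannoy]
  push_cast at h ⊢
  linear_combination -h

theorem sum_turns (n : ℕ) : 2 * ∑ σ ∈ SEP (n + 2), (turns σ : ℝ) =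
    delannoy (n + 2) - 4 * delannoy (n + 1) - delannoy n := by
  have h := congrArg (coeff (n + 2)) two_mul_turnGF
  have e : (1 - 4 * X - X ^ 2) * delannoyGF =
    delannoyGF - 4 * (X * delannoyGF) - X * (X * delannoyGF) := by ring
  rw [e, map_sub, map_sub, map_sub, map_sub, coeff_ofNat_mul, coeff_ofNat_mul, coeff_succ_X_mul,
    coeff_succ_X_mul, coeff_succ_X_mul, coeff_turnGF, coeff_one, coeff_X, if_neg (by omega),
    if_neg (by omega), sub_zero, sub_zero] at h
  exact h

theorem card_SEP_pos (n : ℕ) : 0 < ((SEP (n + 2)).card : ℝ) := by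
  obtain ⟨h, h'⟩ := delannoy_pos_and_le n
  have hn : (0 : ℝ) ≤ n := n.cast_nonneg
  have : 0 < 2 * ((n : ℝ) + 2) * (SEP (n + 2)).card := by rw [card_SEP]; linarith
  exact pos_of_mul_pos_right this (by positivity)

theorem expSep_turns_div (n : ℕ) : expSep (n + 2) turns / (n + 2) =
    (delannoy (n + 2) / delannoy (n + 1) * (delannoy (n + 1) / delannoy n) -
      4 * (delannoy (n + 1) / delannoy n) - 1) / (3 * (delannoy (n + 1) / delannoy n) - 1) := by
  obtain ⟨h, h'⟩ := delannoy_pos_and_le n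
  obtain ⟨h₁, -⟩ := delannoy_pos_and_le (n + 1)
  have hn : (0 : ℝ) ≤ n := n.cast_nonneg
  have hc := card_SEP n
  have ht := sum_turns n
  have hp := card_SEP_pos n
  have e₁ : expSep (n + 2) turns / (n + 2) =
      (delannoy (n + 2) - 4 * delannoy (n + 1) - delannoy n) /
        (3 * delannoy (n + 1) - delannoy n) := by
    rw [← hc, ← ht, expSep]
    field_simp
  have e₂ : 3 * (delannoy (n + 1) / delannoy n) - 1 =
      (3 * delannoy (n + 1) - delannoy n) / delannoy n := by field_simp
  have e₃ : delannoy (n + 2) / delannoy (n + 1) * (delannoy (n + 1) / delannoy n) -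
      4 * (delannoy (n + 1) / delannoy n) - 1 =
      (delannoy (n + 2) - 4 * delannoy (n + 1) - delannoy n) / delannoy n := by field_simp
  rw [e₁, e₂, e₃, div_div_div_cancel_right₀ h.ne']

theorem tendsto_expSep_turns_div :
    Tendsto (fun n : ℕ => expSep n turns / n) atTop (nhds (2 - √2)) := by
  rw [← tendsto_add_atTop_iff_nat 2]
  have hr := tendsto_delannoy_ratio
  have hr' := hr.comp (tendsto_add_atTop_nat 1)
  have hsq : √2 * √2 = 2 := Real.mul_self_sqrt (by norm_num)
  have h0 : 0 ≤ √2 := Real.sqrt_nonneg 2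
  have hd : (3 * (3 + 2 * √2) - 1 : ℝ) ≠ 0 := by linarith
  have hlim := (((hr'.mul hr).sub (hr.const_mul 4)).sub_const 1).div
    ((hr.const_mul 3).sub_const 1) hd
  have e : ((3 + 2 * √2) * (3 + 2 * √2) - 4 * (3 + 2 * √2) - 1) / (3 * (3 + 2 * √2) - 1) =
      2 - √2 := by
    rw [div_eq_iff hd]
    linear_combination 10 * hsq
  rw [e] at hlim
  refine hlim.congr fun n => ?_
  push_cast
  exact (expSep_turns_div n).symm

theorem expSep_le_add_two {n : ℕ} (hn : 2 ≤ n) {A B : Equiv.Perm (Fin n) → ℕ}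
    (h : ∀ σ, A σ ≤ B σ + 2) : expSep n A ≤ expSep n B + 2 := by
  obtain ⟨n, rfl⟩ := Nat.exists_eq_add_of_le' hn
  have hp := card_SEP_pos n
  unfold expSep
  rw [div_add' _ _ _ hp.ne']
  gcongr
  calc ∑ σ ∈ SEP (n + 2), (A σ : ℝ) ≤ ∑ σ ∈ SEP (n + 2), ((B σ : ℝ) + 2) :=
        Finset.sum_le_sum fun σ _ => by exact_mod_cast h σ
    _ = _ := by rw [Finset.sum_add_distrib, Finset.sum_const, nsmul_eq_mul, mul_comm (2 : ℝ)]

/-- Statistics that differ from the number of turns by at most two have its asymptotic mean. -/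
theorem expSep_isEquivalent {A : ∀ n : ℕ, Equiv.Perm (Fin n) → ℕ}
    (h₁ : ∀ n, 2 ≤ n → ∀ σ : Equiv.Perm (Fin n), A n σ ≤ turns σ + 2)
    (h₂ : ∀ n, 2 ≤ n → ∀ σ : Equiv.Perm (Fin n), turns σ ≤ A n σ + 2) :
    (fun n : ℕ => expSep n (A n)) ~[atTop] fun n : ℕ => (2 - √2) * (n : ℝ) := by
  have hL : (2 - √2 : ℝ) ≠ 0 := by
    have : √2 < 2 := by rw [Real.sqrt_lt' (by norm_num)]; norm_num
    linarith
  have hc : Tendsto (fun n : ℕ => (2 : ℝ) / n) atTop (nhds 0) :=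
    tendsto_const_div_atTop_nhds_zero_nat 2
  have hT := tendsto_expSep_turns_div
  have hA : Tendsto (fun n : ℕ => expSep n (A n) / n) atTop (nhds (2 - √2)) := by
    refine tendsto_of_tendsto_of_tendsto_of_le_of_le' (by simpa using hT.sub hc)
      (by simpa using hT.add hc) ?_ ?_
    · filter_upwards [eventually_ge_atTop 2] with n hn
      rw [← sub_div]
      gcongr
      linarith [expSep_le_add_two hn (h₂ n hn)]
    · filter_upwards [eventually_ge_atTop 2] with n hn
      rw [← add_div]
      gcongr
      exact expSep_le_add_two hn (h₁ n hn)
  refine isEquivalent_of_tendsto_one ?_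
  have := hA.div_const (2 - √2)
  rw [div_self hL] at this
  refine this.congr fun n => ?_
  simp only [Pi.div_apply]
  rw [div_div, mul_comm]

end SepAlt

theorem theorem1 :
    ((fun n : ℕ => SepAlt.expSep n SepAlt.altLen) ~[atTop]
        fun n : ℕ => (2 - Real.sqrt 2) * (n : ℝ)) ∧
      (∀ s e : SepAlt.Step,
        (fun n : ℕ => SepAlt.expSep n (SepAlt.altLenType s e)) ~[atTop]
          fun n : ℕ => (2 - Real.sqrt 2) * (n : ℝ)) ∧
      |(2 - Real.sqrt 2) - (0.5858 : ℝ)| < 0.00005 := by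
  refine ⟨SepAlt.expSep_isEquivalent (fun n hn σ => (SepAlt.altLen_eq hn σ).le)
    (fun n hn σ => ?_), fun s e => SepAlt.expSep_isEquivalent
    (fun n hn σ => (SepAlt.altLenType_le_altLen s e σ).trans (SepAlt.altLen_eq hn σ).le)
    (fun n hn σ => ?_), ?_⟩
  · have := SepAlt.altLen_eq hn σ
    omega
  · have := SepAlt.altLen_eq hn σ
    have := SepAlt.altLen_le_altLenType s e σ
    omega
  · have h₁ : 1.41419 < √2 := Real.lt_sqrt_of_sq_lt (by norm_num)
    have h₂ : √2 < 1.41422 := by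
      rw [Real.sqrt_lt' (by norm_num)]
      norm_num
    rw [abs_lt]
    constructor <;> linarith
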